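/- Let $Y$ be a Klein surface, that is, a compact connected nonorientable surface (without boundary) with an atlas of complex-valued charts whose transition functions are, on each connected component of their domains, holomorphic or anti-holomorphic; all charts of the maximal atlas with this property are called compatible. Let $\pi : X \to Y$ be the orientation double cover of $Y$: the points of $X$ are the pairs $(y,o)$ with $y\in Y$ and $o$ an orientation of $T_yY$, and $X$ carries the structure of a Riemann surface whose charts are $(y,o)\mapsto w(y)$ for the compatible charts $w$ of $Y$, on the set of those $(y,o)$ with $y$ in the domain of $w$ for which $w$ is positively oriented at $y$ with respect to $o$. Let $\sigma : X \to X$, $(y,o)\mapsto (y,-o)$, be the anti-holomorphic involution that changes the orientation. A real function $f$ on an open set $W\subseteq Y$ is harmonic if each point of $W$ lies in the domain $U\subseteq W$ of a compatible chart $w$ such that $f\circ w^{-1}$ is harmonic on $w(U)$. A real one-form on $Y$ is harmonic if it is locally of the form $\mathrm{d}f$ with $f$ a harmonic function; let $\mathcal{H}^1_{\mathbb R}(Y)$ be the real vector space of these forms. Let $H^0(X,\Omega)$ be the space of holomorphic one-forms on $X$, and let $H^0(X,\Omega)^{\overline{\sigma^*}}$ be the real vector space of the $\sigma$-invariant ones,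 that is, of those $\omega\in H^0(X,\Omega)$ with $\sigma^*\omega=\overline{\omega}$. Let $*$ be the Hodge operator on one-forms on $X$, given in a local holomorphic coordinate $z = x+\sqrt{-1}\,y$ by $*(a\,\mathrm{d}x+b\,\mathrm{d}y) = -b\,\mathrm{d}x+a\,\mathrm{d}y$. Then: 1. A form $\omega\in H^0(X,\Omega)$ satisfies $\sigma^*\omega=\overline{\omega}$ if and only if there is a form $\eta\in\mathcal{H}^1_{\mathbb R}(Y)$ such that $\omega=\beta+\sqrt{-1}\,(*\beta)$, where $\beta=\pi^*\eta$. 2. The map $\eta\mapsto \pi^*\eta+\sqrt{-1}\,(*\pi^*\eta)$ is an isomorphism of real vector spaces from $\mathcal{H}^1_{\mathbb R}(Y)$ onto $H^0(X,\Omega)^{\overline{\sigma^*}}$. -/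

import Mathlib

open Complex Set Topology Manifold ContDiff InnerProductSpace

noncomputable section

/-- `f` is holomorphic or anti-holomorphic near `z`. -/
def DianalyticAt (f : ℂ → ℂ) (z : ℂ) : Prop :=
  AnalyticAt ℂ f z ∨ AnalyticAt ℂ (fun w => (starRingEnd ℂ) (f w)) z

theorem analyticAt_conj_conj {g : ℂ → ℂ} {z : ℂ} (h : AnalyticAt ℂ g ((starRingEnd ℂ) z)) :
    AnalyticAt ℂ (fun w => (starRingEnd ℂ) (g ((starRingEnd ℂ) w))) z := by
  rw [Complex.analyticAt_iff_eventually_differentiableAt] at h ⊢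
  have hc : Filter.Tendsto (starRingEnd ℂ) (𝓝 z) (𝓝 ((starRingEnd ℂ) z)) :=
    Complex.continuous_conj.continuousAt
  filter_upwards [hc.eventually h] with w hw
  have := hw.star_star
  simpa [Function.comp_def] using this

theorem DianalyticAt.comp {f g : ℂ → ℂ} {z : ℂ} (hg : DianalyticAt g (f z))
    (hf : DianalyticAt f z) : DianalyticAt (g ∘ f) z := by
  rcases hf with hf | hf <;> rcases hg with hg | hg
  · exact Or.inl (hg.comp hf)
  · exact Or.inr (AnalyticAt.comp (g := fun w => (starRingEnd ℂ) (g w)) hg hf)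
  · right
    have h1 : AnalyticAt ℂ (fun w => (starRingEnd ℂ) (g ((starRingEnd ℂ) w)))
        ((fun w => (starRingEnd ℂ) (f w)) z) := analyticAt_conj_conj (by simpa using hg)
    simpa [Function.comp_def] using AnalyticAt.comp (f := fun w => (starRingEnd ℂ) (f w)) h1 hf
  · left
    have h1 : AnalyticAt ℂ (fun w => (starRingEnd ℂ) ((starRingEnd ℂ) (g ((starRingEnd ℂ) w))))
        ((fun w => (starRingEnd ℂ) (f w)) z) :=
      analyticAt_conj_conj (g := fun w => (starRingEnd ℂ) (g w)) (by simpa using hg)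
    simpa [Function.comp_def] using AnalyticAt.comp (f := fun w => (starRingEnd ℂ) (f w)) h1 hf

theorem dianalyticAt_id (z : ℂ) : DianalyticAt id z := Or.inl analyticAt_id

theorem dianalyticAt_conj (z : ℂ) : DianalyticAt (starRingEnd ℂ) z :=
  Or.inr (by
    simp only [Complex.conj_conj]
    exact analyticAt_id)

theorem DianalyticAt.congr {f g : ℂ → ℂ} {z : ℂ} (hf : DianalyticAt f z) (h : f =ᶠ[𝓝 z] g) :
    DianalyticAt g z :=
  hf.imp (fun hf => hf.congr h) (fun hf => hf.congr (h.fun_comp (starRingEnd ℂ)))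

theorem DianalyticAt.contDiffAt {f : ℂ → ℂ} {z : ℂ} (hf : DianalyticAt f z) :
    ContDiffAt ℝ ω f z := by
  rcases hf with hf | hf
  · exact hf.contDiffAt.restrict_scalars ℝ
  · have h1 : ContDiffAt ℝ ω (fun w => (starRingEnd ℂ) (f w)) z := hf.contDiffAt.restrict_scalars ℝ
    have h2 := (conjCLE.contDiff (n := ω)).contDiffAt.comp z h1
    simpa [Function.comp_def] using h2

/-- The pregroupoid of maps that are, near each point, holomorphic or anti-holomorphic. -/
def dianalyticPregroupoid : Pregroupoid ℂ where
  property f s := ∀ z ∈ s, DianalyticAt f z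
  comp hf hg _ _ _ z hz := (hg _ hz.2).comp (hf z hz.1)
  id_mem z _ := dianalyticAt_id z
  locality _ h z hz :=
    let ⟨_, _, h₂, h₃⟩ := h z hz
    h₃ z ⟨hz, h₂⟩
  congr hu h hf z hz :=
    (hf z hz).congr (Filter.eventually_of_mem (hu.mem_nhds hz) fun w hw => (h w hw).symm)

/-- The groupoid of dianalytic transition maps: homeomorphisms between open subsets of `ℂ` which,
near each point (equivalently, on each connected component of the domain), are holomorphic or
anti-holomorphic. -/
def dianalyticGroupoid : StructureGroupoid ℂ := dianalyticPregroupoid.groupoid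

theorem dianalyticAt_of_mem {e : OpenPartialHomeomorph ℂ ℂ} (he : e ∈ dianalyticGroupoid) {z : ℂ}
    (hz : z ∈ e.source) : DianalyticAt e z :=
  (mem_groupoid_of_pregroupoid.1 he).1 z hz

theorem dianalyticGroupoid_le : dianalyticGroupoid ≤ contDiffGroupoid ω 𝓘(ℝ, ℂ) := by
  refine groupoid_of_pregroupoid_le _ _ fun f s h => ?_
  intro z hz
  simp only [mfld_simps] at hz
  exact (h z hz).contDiffAt.contDiffWithinAt

instance : ClosedUnderRestriction dianalyticGroupoid :=
  (closedUnderRestriction_iff_id_le _).mpr (by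
    rw [StructureGroupoid.le_iff]
    rintro e ⟨s, hs, hes⟩
    refine dianalyticGroupoid.mem_of_eqOnSource' _ _ ?_ hes
    exact mem_groupoid_of_pregroupoid.2 ⟨fun z _ => dianalyticAt_id z, fun z _ => dianalyticAt_id z⟩)

theorem conj_mem_dianalyticGroupoid :
    conjCLE.toHomeomorph.toOpenPartialHomeomorph ∈ dianalyticGroupoid :=
  mem_groupoid_of_pregroupoid.2 ⟨fun z _ => dianalyticAt_conj z, fun z _ => dianalyticAt_conj z⟩

section OneForms

variable (M : Type*) [TopologicalSpace M] [ChartedSpace ℂ M]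
  (F : Type*) [NormedAddCommGroup F] [NormedSpace ℝ F]

/-- `F`-valued one-forms on a surface: families of real-linear maps on the real tangent planes.
Real one-forms are `OneForm M ℝ`, complex one-forms `u dz + v dz̄` are `OneForm M ℂ`. -/
abbrev OneForm : Type _ := (x : M) → TangentSpace 𝓘(ℝ, ℂ) x →L[ℝ] F

variable {M F}

/-- The differential `df` of a function (defined by its values where `f` is differentiable). -/
def differential (f : M → F) : OneForm M F := fun x => mfderiv 𝓘(ℝ, ℂ) 𝓘(ℝ, F) f x

end OneForms

section Klein

variable (Y : Type*) [TopologicalSpace Y] [ChartedSpace ℂ Y]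

/-- The compatible charts of `Y`: the charts of the maximal dianalytic atlas, i.e. all charts whose
transition functions to and from the given atlas are dianalytic. -/
def compatibleCharts : Set (OpenPartialHomeomorph Y ℂ) := dianalyticGroupoid.maximalAtlas Y

/-- `Y` is orientable if it is covered by compatible charts any two of which have a holomorphic
(equivalently, orientation preserving) transition function. -/
def IsOrientableSurface : Prop :=
  ∃ A ⊆ compatibleCharts Y, (∀ y : Y, ∃ e ∈ A, y ∈ e.source) ∧
    ∀ e ∈ A, ∀ e' ∈ A, DifferentiableOn ℂ (e.symm ≫ₕ e') (e.symm ≫ₕ e').source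

/-- A Klein surface (without boundary): a compact connected nonorientable surface with a dianalytic
atlas. Second countability is automatic, by compactness. -/
class KleinSurface : Prop extends T2Space Y, CompactSpace Y, ConnectedSpace Y,
    HasGroupoid Y dianalyticGroupoid where
  not_orientable : ¬ IsOrientableSurface Y

/-- The underlying real-analytic (in particular smooth) structure. -/
instance [h : HasGroupoid Y dianalyticGroupoid] : IsManifold 𝓘(ℝ, ℂ) ω Y :=
  { hasGroupoid_of_le h dianalyticGroupoid_le with }

variable {Y}

/-- The Jacobian determinant at `y` of the chart `e`, with respect to the standard basis of the
tangent plane `T_y Y`, which in Mathlib is `ℂ` by means of the preferred chart at `y`. -/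
def chartJacobian (e : OpenPartialHomeomorph Y ℂ) (y : Y) : ℝ :=
  ContinuousLinearMap.det (show ℂ →L[ℝ] ℂ from differential e y)

open Classical in
/-- The orientation of `T_y Y` for which `e` is a positively oriented chart at `y`: the pullback
along `de_y` of the standard orientation of `ℂ` (see `map_chartOrientation`). -/
def chartOrientation (e : OpenPartialHomeomorph Y ℂ) (y : Y) :
    Orientation ℝ (TangentSpace 𝓘(ℝ, ℂ) y) (Fin 2) :=
  if 0 < chartJacobian e y then (show Orientation ℝ ℂ (Fin 2) from Complex.orientation)
  else (show Orientation ℝ ℂ (Fin 2) from -Complex.orientation)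

/-- The differential of `e` carries `chartOrientation e y` to the standard orientation of `ℂ`. -/
theorem map_chartOrientation (e : OpenPartialHomeomorph Y ℂ) (y : Y)
    (L : TangentSpace 𝓘(ℝ, ℂ) y ≃ₗ[ℝ] ℂ) (hL : ∀ v, L v = differential e y v) :
    Orientation.map (Fin 2) L (chartOrientation e y) = Complex.orientation := by
  let L' : ℂ ≃ₗ[ℝ] ℂ := L
  have hdet : chartJacobian e y = LinearMap.det (L' : ℂ →ₗ[ℝ] ℂ) :=
    congrArg LinearMap.det (LinearMap.ext fun v => (hL v).symm)
  have hc : Fintype.card (Fin 2) = Module.finrank ℝ ℂ := by simp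
  have hne : LinearMap.det (L' : ℂ →ₗ[ℝ] ℂ) ≠ 0 := (LinearEquiv.isUnit_det' L').ne_zero
  by_cases h : 0 < chartJacobian e y
  · have h1 : chartOrientation e y = (show Orientation ℝ ℂ (Fin 2) from Complex.orientation) :=
      if_pos h
    rw [hdet] at h
    rw [h1]
    exact (Orientation.map_eq_iff_det_pos Complex.orientation L' hc).2 h
  · have h1 : chartOrientation e y = (show Orientation ℝ ℂ (Fin 2) from -Complex.orientation) :=
      if_neg h
    rw [hdet] at h
    rw [h1]
    have h2 := (Orientation.map_eq_neg_iff_det_neg Complex.orientation L' hc).2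
      (lt_of_le_of_ne (not_lt.1 h) hne)
    have h3 := Orientation.map_neg L' Complex.orientation
    rw [h2] at h3
    exact h3.trans (neg_neg Complex.orientation)

theorem mdifferentiableAt_compatible [HasGroupoid Y dianalyticGroupoid]
    {e : OpenPartialHomeomorph Y ℂ} (he : e ∈ compatibleCharts Y) {y : Y} (hy : y ∈ e.source) :
    MDifferentiableAt 𝓘(ℝ, ℂ) 𝓘(ℝ, ℂ) e y := by
  have h1 : e ∈ IsManifold.maximalAtlas 𝓘(ℝ, ℂ) ω Y :=
    StructureGroupoid.maximalAtlas_mono dianalyticGroupoid_le he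
  exact (contMDiffAt_of_mem_maximalAtlas h1 hy).mdifferentiableAt (by simp)

theorem differential_comp [HasGroupoid Y dianalyticGroupoid] {F : Type*} [NormedAddCommGroup F]
    [NormedSpace ℝ F] {e : OpenPartialHomeomorph Y ℂ} (he : e ∈ compatibleCharts Y) {y : Y}
    (hy : y ∈ e.source) {f : Y → F} (hf : DifferentiableAt ℝ (f ∘ e.symm) (e y)) (v : ℂ) :
    (differential f y : ℂ → F) v = fderiv ℝ (f ∘ e.symm) (e y) ((differential e y : ℂ → ℂ) v) := by
  have h1 : f =ᶠ[𝓝 y] (f ∘ e.symm) ∘ e :=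
    Filter.eventually_of_mem (e.open_source.mem_nhds hy) fun w hw => by simp [e.left_inv hw]
  have h2 : mfderiv 𝓘(ℝ, ℂ) 𝓘(ℝ, F) f y = mfderiv 𝓘(ℝ, ℂ) 𝓘(ℝ, F) ((f ∘ e.symm) ∘ e) y :=
    h1.mfderiv_eq
  have h3 := mfderiv_comp (I := 𝓘(ℝ, ℂ)) (I' := 𝓘(ℝ, ℂ)) (I'' := 𝓘(ℝ, F)) y
    (hf.mdifferentiableAt) (mdifferentiableAt_compatible he hy)
  rw [mfderiv_eq_fderiv] at h3
  exact congrArg (fun T : ℂ →L[ℝ] F => T v) (h2.trans h3)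

theorem dianalyticAt_transition {e e' : OpenPartialHomeomorph Y ℂ} [HasGroupoid Y dianalyticGroupoid]
    (he : e ∈ compatibleCharts Y) (he' : e' ∈ compatibleCharts Y) {y : Y} (hy : y ∈ e.source)
    (hy' : y ∈ e'.source) : DianalyticAt (e' ∘ e.symm) (e y) :=
  dianalyticAt_of_mem (dianalyticGroupoid.compatible_of_mem_maximalAtlas he he')
    (by simp [hy, hy'])

theorem chartJacobian_trans {e e' : OpenPartialHomeomorph Y ℂ} [HasGroupoid Y dianalyticGroupoid]
    (he : e ∈ compatibleCharts Y) (he' : e' ∈ compatibleCharts Y) {y : Y} (hy : y ∈ e.source)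
    (hy' : y ∈ e'.source) :
    chartJacobian e' y = (fderiv ℝ (e' ∘ e.symm) (e y)).det * chartJacobian e y := by
  have hd : DifferentiableAt ℝ (e' ∘ e.symm) (e y) :=
    (dianalyticAt_transition he he' hy hy').contDiffAt.differentiableAt (by simp)
  have h1 : (show ℂ →L[ℝ] ℂ from differential e' y) =
      (fderiv ℝ (e' ∘ e.symm) (e y)).comp (show ℂ →L[ℝ] ℂ from differential e y) :=
    ContinuousLinearMap.ext fun v => differential_comp he hy hd v
  unfold chartJacobian
  rw [h1]
  exact LinearMap.det_comp _ _

theorem chartJacobian_chartAt [HasGroupoid Y dianalyticGroupoid] (y : Y) :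
    chartJacobian (chartAt ℂ y) y = 1 := by
  have h : (show ℂ →L[ℝ] ℂ from differential (chartAt ℂ y) y) = ContinuousLinearMap.id ℝ ℂ := by
    have := mfderiv_extChartAt_self (I := 𝓘(ℝ, ℂ)) (x := y)
    simpa [differential] using! this
  unfold chartJacobian
  rw [h]
  exact LinearMap.det_id

theorem chartJacobian_ne_zero [HasGroupoid Y dianalyticGroupoid]
    {e : OpenPartialHomeomorph Y ℂ} (he : e ∈ compatibleCharts Y) {y : Y} (hy : y ∈ e.source) :
    chartJacobian e y ≠ 0 := fun h0 => by
  have h := chartJacobian_trans he (dianalyticGroupoid.chart_mem_maximalAtlas y) hy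
    (mem_chart_source ℂ y)
  rw [chartJacobian_chartAt, h0, mul_zero] at h
  exact one_ne_zero h

theorem det_fderiv_nonneg_of_analyticAt {f : ℂ → ℂ} {z : ℂ} (hf : AnalyticAt ℂ f z) :
    0 ≤ (fderiv ℝ f z).det := by
  have h := hf.differentiableAt.hasDerivAt.complexToReal_fderiv.fderiv
  rw [h]
  have h2 : (deriv f z • (1 : ℂ →L[ℝ] ℂ)).det = Algebra.norm ℝ (deriv f z) := by
    rw [Algebra.norm_apply]
    exact congrArg LinearMap.det (LinearMap.ext fun v => by simp)
  rw [h2, Algebra.norm_complex_apply]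
  exact Complex.normSq_nonneg _

theorem det_conjCLE : (conjCLE : ℂ →L[ℝ] ℂ).det = -1 :=
  (by simp : LinearMap.det ((conjCLE : ℂ →L[ℝ] ℂ) : ℂ →ₗ[ℝ] ℂ) = -1)

theorem det_fderiv_nonpos_of_analyticAt_conj {f : ℂ → ℂ} {z : ℂ}
    (hf : AnalyticAt ℂ (fun w => (starRingEnd ℂ) (f w)) z) : (fderiv ℝ f z).det ≤ 0 := by
  have h1 := det_fderiv_nonneg_of_analyticAt hf
  have h0 : DianalyticAt f z := Or.inr hf
  have hd : DifferentiableAt ℝ f z := h0.contDiffAt.differentiableAt (by simp)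
  have h2 : fderiv ℝ (fun w => (starRingEnd ℂ) (f w)) z =
      (conjCLE : ℂ →L[ℝ] ℂ).comp (fderiv ℝ f z) :=
    ((conjCLE : ℂ →L[ℝ] ℂ).hasFDerivAt.comp z hd.hasFDerivAt).fderiv
  rw [h2] at h1
  have h3 : ((conjCLE : ℂ →L[ℝ] ℂ).comp (fderiv ℝ f z)).det = - (fderiv ℝ f z).det := by
    refine (LinearMap.det_comp _ _).trans ?_
    exact (congrArg (· * (fderiv ℝ f z).det) det_conjCLE).trans (neg_one_mul _)
  linarith

theorem orientation_ne_neg : (Complex.orientation : Orientation ℝ ℂ (Fin 2)) ≠ -Complex.orientation :=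
  Module.Ray.ne_neg_self _

theorem chartOrientation_eq_iff {e e' : OpenPartialHomeomorph Y ℂ} {y : Y} :
    chartOrientation e y = chartOrientation e' y ↔
      (0 < chartJacobian e y ↔ 0 < chartJacobian e' y) := by
  have h0 := orientation_ne_neg
  have h0' := orientation_ne_neg.symm
  unfold chartOrientation
  by_cases h : 0 < chartJacobian e y <;> by_cases h' : 0 < chartJacobian e' y <;>
    simp only [h, h', ↓reduceIte] <;> tauto

theorem analyticAt_transition_iff {e e' : OpenPartialHomeomorph Y ℂ}
    [HasGroupoid Y dianalyticGroupoid] (he : e ∈ compatibleCharts Y) (he' : e' ∈ compatibleCharts Y)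
    {y : Y} (hy : y ∈ e.source) (hy' : y ∈ e'.source) :
    AnalyticAt ℂ (e' ∘ e.symm) (e y) ↔ chartOrientation e y = chartOrientation e' y := by
  have h1 := chartJacobian_trans he he' hy hy'
  have h2 := chartJacobian_ne_zero he hy
  have h3 := chartJacobian_ne_zero he' hy'
  have h4 : (fderiv ℝ (e' ∘ e.symm) (e y)).det ≠ 0 := fun h0 => h3 (by rw [h1, h0, zero_mul])
  rw [chartOrientation_eq_iff, h1]
  constructor
  · intro h
    rw [mul_pos_iff_of_pos_left (lt_of_le_of_ne (det_fderiv_nonneg_of_analyticAt h) h4.symm)]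
  · intro h
    rcases dianalyticAt_transition he he' hy hy' with h5 | h5
    · exact h5
    · exfalso
      have h6 := lt_of_le_of_ne (det_fderiv_nonpos_of_analyticAt_conj h5) h4
      rcases lt_or_gt_of_ne h2 with h7 | h7
      · exact absurd (h.2 (mul_pos_of_neg_of_neg h6 h7)) (not_lt.2 h7.le)
      · exact absurd (h.1 h7) (not_lt.2 (mul_neg_of_neg_of_pos h6 h7).le)

variable (Y) in
/-- The orientation double cover: pairs (point of `Y`, orientation of the tangent plane there). -/
@[ext]
structure OrientationCover where
  /-- the underlying point of `Y` -/
  pt : Y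
  /-- the orientation of the tangent plane at that point -/
  orient : Orientation ℝ (TangentSpace 𝓘(ℝ, ℂ) pt) (Fin 2)

namespace OrientationCover

/-- The projection `π : X → Y`. -/
def proj (x : OrientationCover Y) : Y := x.pt

/-- The change of orientation `σ : X → X`. -/
def involution (x : OrientationCover Y) : OrientationCover Y := ⟨x.pt, -x.orient⟩

@[simp] theorem proj_involution (x : OrientationCover Y) : x.involution.proj = x.proj := rfl

@[simp] theorem involution_involution (x : OrientationCover Y) : x.involution.involution = x :=
  congrArg (OrientationCover.mk x.pt) (neg_neg (x.orient : Module.Ray ℝ _))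

/-- The chart of `X` induced by a compatible chart `e` of `Y`: its domain consists of the points of
the domain of `e`, with the orientation for which `e` is positively oriented. -/
def liftChart (e : OpenPartialHomeomorph Y ℂ) : PartialEquiv (OrientationCover Y) ℂ where
  toFun x := e x.pt
  invFun z := ⟨e.symm z, chartOrientation e (e.symm z)⟩
  source := {x | x.pt ∈ e.source ∧ x.orient = chartOrientation e x.pt}
  target := e.target
  map_source' _ hx := e.map_source hx.1
  map_target' _ hz := ⟨e.map_target hz, rfl⟩
  left_inv' := by
    rintro ⟨y, o⟩ ⟨hy, ho⟩
    simp only at hy ho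
    subst ho
    exact congrArg (fun w => (⟨w, chartOrientation e w⟩ : OrientationCover Y)) (e.left_inv hy)
  right_inv' _ hz := e.right_inv hz

open Classical in
/-- A compatible chart of `Y` that is positively oriented at `x`: the preferred chart of `Y` or its
complex conjugate. -/
def preferredChart (x : OrientationCover Y) : OpenPartialHomeomorph Y ℂ :=
  if x.orient = chartOrientation (chartAt ℂ x.pt) x.pt then chartAt ℂ x.pt
  else chartAt ℂ x.pt ≫ₕ conjCLE.toHomeomorph.toOpenPartialHomeomorph

theorem conj_compatible [HasGroupoid Y dianalyticGroupoid] (y : Y) :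
    chartAt ℂ y ≫ₕ conjCLE.toHomeomorph.toOpenPartialHomeomorph ∈ compatibleCharts Y := by
  refine mem_maximalAtlas_iff.2 fun e he => ?_
  have hc := dianalyticGroupoid.compatible (chart_mem_atlas ℂ y) he
  have hc' := dianalyticGroupoid.compatible he (chart_mem_atlas ℂ y)
  constructor
  · rw [OpenPartialHomeomorph.trans_symm_eq_symm_trans_symm, OpenPartialHomeomorph.trans_assoc]
    exact dianalyticGroupoid.trans (dianalyticGroupoid.symm conj_mem_dianalyticGroupoid) hc
  · rw [← OpenPartialHomeomorph.trans_assoc]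
    exact dianalyticGroupoid.trans hc' conj_mem_dianalyticGroupoid

theorem preferredChart_mem [HasGroupoid Y dianalyticGroupoid] (x : OrientationCover Y) :
    preferredChart x ∈ compatibleCharts Y := by
  unfold preferredChart
  split_ifs
  · exact dianalyticGroupoid.chart_mem_maximalAtlas _
  · exact conj_compatible _

theorem mem_preferredChart_source [HasGroupoid Y dianalyticGroupoid] (x : OrientationCover Y) :
    x ∈ (liftChart (preferredChart x)).source := by
  have hs := mem_chart_source ℂ x.pt
  by_cases h : x.orient = chartOrientation (chartAt ℂ x.pt) x.pt
  · have h1 : preferredChart x = chartAt ℂ x.pt := if_pos h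
    rw [h1]
    exact ⟨hs, h⟩
  · have h1 : preferredChart x = chartAt ℂ x.pt ≫ₕ conjCLE.toHomeomorph.toOpenPartialHomeomorph :=
      if_neg h
    rw [h1]
    have hs' : x.pt ∈ (chartAt ℂ x.pt ≫ₕ conjCLE.toHomeomorph.toOpenPartialHomeomorph).source := by
      simp
    refine ⟨hs', ?_⟩
    set e := chartAt ℂ x.pt with he
    set e' := e ≫ₕ conjCLE.toHomeomorph.toOpenPartialHomeomorph with he'
    have hec : e ∈ compatibleCharts Y := dianalyticGroupoid.chart_mem_maximalAtlas _
    have hne : chartOrientation e x.pt ≠ chartOrientation e' x.pt := by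
      intro h0
      have h2 := (analyticAt_transition_iff hec (conj_compatible x.pt) hs hs').2 h0
      have h3 : AnalyticAt ℂ (starRingEnd ℂ) (e x.pt) := by
        refine h2.congr ?_
        filter_upwards [e.open_target.mem_nhds (e.map_source hs)] with z hz
        exact congrArg (starRingEnd ℂ) (e.right_inv hz)
      have h4 := det_fderiv_nonneg_of_analyticAt h3
      have h5 : fderiv ℝ (starRingEnd ℂ) (e x.pt) = (conjCLE : ℂ →L[ℝ] ℂ) :=
        (conjCLE : ℂ →L[ℝ] ℂ).hasFDerivAt.fderiv
      rw [h5, det_conjCLE] at h4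
      linarith
    have hor : ∀ o o' o'' : Orientation ℝ ℂ (Fin 2), o ≠ o' → o' ≠ o'' → o = o'' := by
      intro o o' o'' h1 h2
      have hc : Fintype.card (Fin 2) = Module.finrank ℝ ℂ := by simp
      rw [Orientation.ne_iff_eq_neg _ _ hc] at h1 h2
      rw [h1, h2, neg_neg]
    exact hor _ _ _ h hne

/-- The lifts of all compatible charts of `Y` form an atlas of `X`; it defines the topology and the
complex structure of `X`. -/
def core [HasGroupoid Y dianalyticGroupoid] : ChartedSpaceCore ℂ (OrientationCover Y) where
  atlas := liftChart '' compatibleCharts Y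
  chartAt x := liftChart (preferredChart x)
  mem_chart_source := mem_preferredChart_source
  chart_mem_atlas x := mem_image_of_mem _ (preferredChart_mem x)
  open_source := by
    rintro _ _ ⟨e, he, rfl⟩ ⟨e', he', rfl⟩
    rw [isOpen_iff_mem_nhds]
    rintro z ⟨hz, hz1, hz2⟩
    have hz : z ∈ e.target := hz
    have hy : e.symm z ∈ e.source := e.map_target hz
    have hy' : e.symm z ∈ e'.source := hz1
    have h1 := (analyticAt_transition_iff he he' hy hy').2 hz2
    rw [e.right_inv hz] at h1
    have h2 : (e.symm ≫ₕ e').source ∈ 𝓝 z := (e.symm ≫ₕ e').open_source.mem_nhds (by simp [hz, hy'])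
    filter_upwards [h1.eventually_analyticAt, h2] with w hw hw'
    simp only [mfld_simps] at hw'
    refine ⟨hw'.1, hw'.2, ?_⟩
    refine (analyticAt_transition_iff he he' (e.map_target hw'.1) hw'.2).1 ?_
    rwa [e.right_inv hw'.1]
  continuousOn_toFun := by
    rintro _ _ ⟨e, he, rfl⟩ ⟨e', he', rfl⟩
    exact (e.symm ≫ₕ e').continuousOn.mono fun z hz => by
      simp only [mfld_simps]
      exact ⟨hz.1, hz.2.1⟩

instance [HasGroupoid Y dianalyticGroupoid] : TopologicalSpace (OrientationCover Y) :=
  core.toTopologicalSpace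

instance [HasGroupoid Y dianalyticGroupoid] : ChartedSpace ℂ (OrientationCover Y) :=
  core.toChartedSpace

theorem mem_atlas_iff [HasGroupoid Y dianalyticGroupoid]
    {f : OpenPartialHomeomorph (OrientationCover Y) ℂ} :
    f ∈ atlas ℂ (OrientationCover Y) ↔ ∃ e, ∃ he : e ∈ core.atlas (M := OrientationCover Y),
      f = core.openPartialHomeomorph e he := by
  change f ∈ ⋃ (e : PartialEquiv (OrientationCover Y) ℂ) (he : e ∈ core.atlas),
    {core.openPartialHomeomorph e he} ↔ _
  simp only [mem_iUnion, mem_singleton_iff]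

/-- `X` is a Riemann surface: the transition functions are holomorphic. -/
instance [HasGroupoid Y dianalyticGroupoid] : IsManifold 𝓘(ℂ) ω (OrientationCover Y) := by
  refine isManifold_of_contDiffOn _ _ _ fun f f' hf hf' => ?_
  obtain ⟨_, ⟨e, he, rfl⟩, rfl⟩ := mem_atlas_iff.1 hf
  obtain ⟨_, ⟨e', he', rfl⟩, rfl⟩ := mem_atlas_iff.1 hf'
  simp only [mfld_simps]
  rintro z ⟨hz, hz1, hz2⟩
  have hz : z ∈ e.target := hz
  have h1 := (analyticAt_transition_iff he he' (e.map_target hz) hz1).2 hz2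
  rw [e.right_inv hz] at h1
  exact h1.contDiffAt.contDiffWithinAt

end OrientationCover

/-! ### Harmonic functions and harmonic one-forms -/

/-- A function is harmonic on `W ⊆ Y` if every point of `W` lies in the domain `U ⊆ W` of a
compatible chart `w` such that `f ∘ w⁻¹` is harmonic on `w(U)`. -/
def IsHarmonicFunctionOn (f : Y → ℝ) (W : Set Y) : Prop :=
  ∀ y ∈ W, ∃ e ∈ compatibleCharts Y, y ∈ e.source ∧ e.source ⊆ W ∧
    HarmonicOnNhd (f ∘ e.symm) e.target

/-- A real one-form is harmonic if it is locally `df` with `f` a harmonic function. -/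
def IsHarmonicForm (η : OneForm Y ℝ) : Prop :=
  ∀ y : Y, ∃ U : Set Y, IsOpen U ∧ y ∈ U ∧ ∃ f : Y → ℝ, IsHarmonicFunctionOn f U ∧
    ∀ z ∈ U, η z = differential f z

theorem harmonicAt_comp_of_analyticAt {g : ℂ → ℝ} {f : ℂ → ℂ} {z : ℂ} (hg : HarmonicAt g (f z))
    (hf : AnalyticAt ℂ f z) : HarmonicAt (g ∘ f) z := by
  obtain ⟨r, hr, hr'⟩ := Metric.eventually_nhds_iff_ball.1 hg.eventually
  obtain ⟨G, hG, hG'⟩ := InnerProductSpace.HarmonicOnNhd.exists_analyticOnNhd_ball_re_eq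
    (fun w hw => hr' w hw)
  have h1 : AnalyticAt ℂ (G ∘ f) z := (hG _ (Metric.mem_ball_self hr)).comp hf
  refine (harmonicAt_congr_nhds ?_).2 h1.harmonicAt_re
  filter_upwards [hf.continuousAt.preimage_mem_nhds (Metric.ball_mem_nhds _ hr)] with w hw
  exact (hG' hw).symm

theorem harmonicAt_comp_of_dianalyticAt {g : ℂ → ℝ} {f : ℂ → ℂ} {z : ℂ}
    (hg : HarmonicAt g (f z)) (hf : DianalyticAt f z) : HarmonicAt (g ∘ f) z := by
  rcases hf with hf | hf
  · exact harmonicAt_comp_of_analyticAt hg hf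
  · obtain ⟨r, hr, hr'⟩ := Metric.eventually_nhds_iff_ball.1 hg.eventually
    obtain ⟨G, hG, hG'⟩ := InnerProductSpace.HarmonicOnNhd.exists_analyticOnNhd_ball_re_eq
      (fun w hw => hr' w hw)
    have h0 : AnalyticAt ℂ (fun w => (starRingEnd ℂ) (G ((starRingEnd ℂ) w)))
        ((fun w => (starRingEnd ℂ) (f w)) z) :=
      analyticAt_conj_conj (by simpa using hG _ (Metric.mem_ball_self hr))
    have h1 := (AnalyticAt.comp (f := fun w => (starRingEnd ℂ) (f w)) h0 hf).harmonicAt_re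
    have hfc : ContinuousAt f z :=
      (DianalyticAt.contDiffAt (Or.inr hf : DianalyticAt f z)).continuousAt
    refine (harmonicAt_congr_nhds ?_).2 h1
    filter_upwards [hfc.preimage_mem_nhds (Metric.ball_mem_nhds _ hr)] with w hw
    simpa using (hG' hw).symm

section

variable [HasGroupoid Y dianalyticGroupoid]

theorem IsHarmonicFunctionOn.harmonicAt {f : Y → ℝ} {W : Set Y} (hf : IsHarmonicFunctionOn f W)
    {e : OpenPartialHomeomorph Y ℂ} (he : e ∈ compatibleCharts Y) {y : Y} (hy : y ∈ e.source)
    (hyW : y ∈ W) : HarmonicAt (f ∘ e.symm) (e y) := by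
  obtain ⟨e', he', hy', -, hh⟩ := hf y hyW
  have h1 : HarmonicAt ((f ∘ e'.symm) ∘ (e' ∘ e.symm)) (e y) :=
    harmonicAt_comp_of_dianalyticAt
      (by simpa [e.left_inv hy] using hh _ (e'.map_source hy'))
      (dianalyticAt_transition he he' hy hy')
  refine (harmonicAt_congr_nhds ?_).1 h1
  have h2 : (e.symm ≫ₕ e').source ∈ 𝓝 (e y) :=
    (e.symm ≫ₕ e').open_source.mem_nhds (by simp [hy, hy'])
  filter_upwards [h2] with w hw
  simp only [mfld_simps] at hw
  simp [e'.left_inv hw.2]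

theorem isHarmonicFunctionOn_iff {f : Y → ℝ} {W : Set Y} (hW : IsOpen W) :
    IsHarmonicFunctionOn f W ↔ ∀ e ∈ compatibleCharts Y, ∀ y ∈ e.source, y ∈ W →
      HarmonicAt (f ∘ e.symm) (e y) := by
  refine ⟨fun hf e he y hy hyW => hf.harmonicAt he hy hyW, fun h y hy => ?_⟩
  have hc : chartAt ℂ y ∈ compatibleCharts Y := dianalyticGroupoid.chart_mem_maximalAtlas y
  have hr : (chartAt ℂ y).restr W ∈ compatibleCharts Y :=
    restr_mem_maximalAtlas dianalyticGroupoid hc hW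
  refine ⟨(chartAt ℂ y).restr W, hr, by simp [hW.interior_eq, hy], by simp [hW.interior_eq], ?_⟩
  intro z hz
  have hs := ((chartAt ℂ y).restr W).map_target hz
  have h1 := h _ hr _ hs (by simpa [hW.interior_eq] using hs.2)
  rwa [((chartAt ℂ y).restr W).right_inv hz] at h1

theorem IsHarmonicFunctionOn.mdifferentiableAt {f : Y → ℝ} {W : Set Y}
    (hf : IsHarmonicFunctionOn f W) {y : Y} (hy : y ∈ W) :
    MDifferentiableAt 𝓘(ℝ, ℂ) 𝓘(ℝ, ℝ) f y := by
  have hc : chartAt ℂ y ∈ compatibleCharts Y := dianalyticGroupoid.chart_mem_maximalAtlas y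
  have hs := mem_chart_source ℂ y
  have h1 := (hf.harmonicAt hc hs hy).1.differentiableAt (by simp)
  have h2 := h1.mdifferentiableAt.comp y (mdifferentiableAt_compatible hc hs)
  refine h2.congr_of_eventuallyEq ?_
  filter_upwards [(chartAt ℂ y).open_source.mem_nhds hs] with w hw
  simp [(chartAt ℂ y).left_inv hw]

variable (Y) in
/-- The real vector space `H¹_ℝ(Y)` of harmonic real one-forms on `Y`. -/
def harmonicForms : Submodule ℝ (OneForm Y ℝ) where
  carrier := {η | IsHarmonicForm η}
  zero_mem' y := by
    refine ⟨univ, isOpen_univ, mem_univ y, fun _ => 0, ?_, fun z _ => ?_⟩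
    · exact (isHarmonicFunctionOn_iff isOpen_univ).2 fun e _ y _ _ => harmonicAt_const (0 : ℝ)
    · exact (mfderiv_const (I := 𝓘(ℝ, ℂ)) (I' := 𝓘(ℝ, ℝ)) (c := (0 : ℝ)) (x := z)).symm
  add_mem' {η η'} h h' y := by
    obtain ⟨U, hU, hyU, f, hf, hηf⟩ := h y
    obtain ⟨U', hU', hyU', f', hf', hηf'⟩ := h' y
    refine ⟨U ∩ U', hU.inter hU', ⟨hyU, hyU'⟩, f + f', ?_, fun z hz => ?_⟩
    · exact (isHarmonicFunctionOn_iff (hU.inter hU')).2 fun e he y hy hyW =>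
        (hf.harmonicAt he hy hyW.1).add (hf'.harmonicAt he hy hyW.2)
    · have h1 := mfderiv_add (hf.mdifferentiableAt hz.1) (hf'.mdifferentiableAt hz.2)
      have h2 : (η + η') z = differential f z + differential f' z := by
        rw [Pi.add_apply, hηf z hz.1, hηf' z hz.2]
      exact h2.trans h1.symm
  smul_mem' c {η} h y := by
    obtain ⟨U, hU, hyU, f, hf, hηf⟩ := h y
    refine ⟨U, hU, hyU, c • f, ?_, fun z hz => ?_⟩
    · exact (isHarmonicFunctionOn_iff hU).2 fun e he y hy hyW =>
        (hf.harmonicAt he hy hyW).const_smul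
    · have h1 := const_smul_mfderiv (hf.mdifferentiableAt hz) c
      have h2 : (c • η) z = c • differential f z := by
        rw [Pi.smul_apply, hηf z hz]
      exact h2.trans h1.symm

end

end Klein

section RiemannSurface

variable {M : Type*} [TopologicalSpace M] [ChartedSpace ℂ M]
  {N : Type*} [TopologicalSpace N] [ChartedSpace ℂ N]
  {F : Type*} [NormedAddCommGroup F] [NormedSpace ℝ F]

namespace OneForm

/-- The pullback `φ^*α` of a one-form along a smooth map: `(φ^*α)_x = α_{φ(x)} ∘ dφ_x`. -/
def pullback (φ : M → N) (α : OneForm N F) : OneForm M F := fun x =>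
  (α (φ x)).comp (mfderiv 𝓘(ℝ, ℂ) 𝓘(ℝ, ℂ) φ x)

/-- The complex conjugate of a complex one-form. -/
def conj (α : OneForm M ℂ) : OneForm M ℂ := fun x => (conjCLE : ℂ →L[ℝ] ℂ).comp (α x)

/-- A real one-form, viewed as a complex one-form. -/
def ofReal (α : OneForm M ℝ) : OneForm M ℂ := fun x => ofRealCLM.comp (α x)

/-- The complex structure of the tangent plane of a Riemann surface: multiplication by `i` in the
holomorphic coordinate given by the preferred chart at `x`. -/
def complexStructure (x : M) : TangentSpace 𝓘(ℝ, ℂ) x →L[ℝ] TangentSpace 𝓘(ℝ, ℂ) x :=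
  show ℂ →L[ℝ] ℂ from I • ContinuousLinearMap.id ℝ ℂ

/-- The Hodge star operator on one-forms of a Riemann surface, `(*α)(v) = -α(iv)`. So in a local
holomorphic coordinate `z = x + iy`, `*(a dx + b dy) = -b dx + a dy` and
`*(u dz + v dz̄) = -i u dz + i v dz̄`. -/
def hodgeStar (α : OneForm M F) : OneForm M F := fun x => -(α x).comp (complexStructure x)

end OneForm

/-- A complex one-form on a Riemann surface is holomorphic if in every chart `z` of the atlas it is
`f dz` with `f` a holomorphic function. -/
def IsHolomorphicForm (θ : OneForm M ℂ) : Prop :=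
  ∀ e ∈ atlas ℂ M, ∃ f : ℂ → ℂ, DifferentiableOn ℂ f e.target ∧
    ∀ x ∈ e.source, θ x = f (e x) • differential e x

variable (M) in
/-- The complex vector space `H⁰(M, Ω)` of holomorphic one-forms on a Riemann surface. -/
def holomorphicForms : Submodule ℂ (OneForm M ℂ) where
  carrier := {θ | IsHolomorphicForm θ}
  zero_mem' e _ := ⟨fun _ => 0, differentiableOn_const 0, fun x _ => (zero_smul ℂ _).symm⟩
  add_mem' {θ θ'} h h' e he := by
    obtain ⟨f, hf, hθ⟩ := h e he
    obtain ⟨f', hf', hθ'⟩ := h' e he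
    refine ⟨fun z => f z + f' z, hf.add hf', fun x hx => ?_⟩
    rw [Pi.add_apply, hθ x hx, hθ' x hx]
    exact (add_smul _ _ _).symm
  smul_mem' c {θ} h e he := by
    obtain ⟨f, hf, hθ⟩ := h e he
    refine ⟨fun z => c * f z, hf.const_mul c, fun x hx => ?_⟩
    rw [Pi.smul_apply, hθ x hx]
    exact (mul_smul _ _ _).symm

end RiemannSurface

section

variable (Y : Type*) [TopologicalSpace Y] [ChartedSpace ℂ Y] [HasGroupoid Y dianalyticGroupoid]

/-- The real vector space of `σ`-invariant holomorphic one-forms on the orientation double cover,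
i.e. those with `σ^*θ = conj θ`. -/
def sigmaInvariantForms : Submodule ℝ (OneForm (OrientationCover Y) ℂ) where
  carrier := {θ | θ ∈ holomorphicForms (OrientationCover Y) ∧
    OneForm.pullback OrientationCover.involution θ = OneForm.conj θ}
  zero_mem' := ⟨zero_mem _, by
    funext x; ext v; simp [OneForm.pullback, OneForm.conj]⟩
  add_mem' {θ θ'} h h' := ⟨add_mem h.1 h'.1, by
    have h1 : OneForm.pullback OrientationCover.involution (θ + θ') =
      OneForm.pullback OrientationCover.involution θ + OneForm.pullback OrientationCover.involution θ' := rfl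
    rw [h1, h.2, h'.2]
    funext x; ext v; simp [OneForm.conj]⟩
  smul_mem' c {θ} h := ⟨(holomorphicForms _).smul_of_tower_mem c h.1, by
    have h1 : OneForm.pullback OrientationCover.involution (c • θ) =
      c • OneForm.pullback OrientationCover.involution θ := rfl
    rw [h1, h.2]
    funext x; ext v; simp [OneForm.conj]⟩

end

end

/-! Everything rests on linear algebra in one tangent plane plus the local correspondence between
harmonic functions and real parts of holomorphic ones.

Since `(*β)(v) = -β(iv)`, the form `β + i *β` sends `v` to `β(v) - i β(iv)`: it is the unique
complex-linear form with real part `β`. A holomorphic form `θ` is complex linear on tangent planes,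
so `θ = β + i *β` with `β = Re θ` (`eq_addIHodge`). The question is therefore which real forms `β`
occur.

From `Y` to `X`: locally `η = df` with `f = Re G` in a chart `e`, where `G` is holomorphic on a
disc. Then `π^*η = Re (G' de)`, so `π^*η + i *π^*η = G' de` is holomorphic
(`isHolomorphicForm_addIHodge`). Because `π ∘ σ = π` and `dσ` anticommutes with `i`, pulling back by
`σ` fixes `π^*η` and changes the sign of `*π^*η`, which is conjugation
(`pullback_involution_addIHodge`).

From `X` to `Y`: if `σ^*θ = conj θ`, then `Re θ` takes the same values on both sheets and descends
to a form `η` on `Y` (`pullback_proj_descendRe`). A local primitive `G` of `θ` gives `η = d(Re G)`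
in the chart, so `η` is harmonic (`isHarmonicForm_descendRe`).

The correspondence is injective because real parts recover `π^*η`, while `π` and each `dπ` are
surjective. -/

noncomputable section

/-! ### One-forms and differentials in tangent coordinates -/

/-- A one-form at a point, as a linear map on `ℂ`: Mathlib identifies the tangent planes with the
model space by means of the preferred charts. -/
def OneForm.coord {M F : Type*} [TopologicalSpace M] [ChartedSpace ℂ M] [NormedAddCommGroup F]
    [NormedSpace ℝ F] (α : OneForm M F) (x : M) : ℂ →L[ℝ] F := α x

theorem OneForm.ext_coord {M F : Type*} [TopologicalSpace M] [ChartedSpace ℂ M]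
    [NormedAddCommGroup F] [NormedSpace ℝ F] {α β : OneForm M F}
    (h : ∀ x v, OneForm.coord α x v = OneForm.coord β x v) : α = β :=
  funext fun x => (ContinuousLinearMap.ext (h x) : OneForm.coord α x = OneForm.coord β x)

theorem differential_comp_apply {M F : Type*} [TopologicalSpace M] [ChartedSpace ℂ M]
    [NormedAddCommGroup F] [NormedSpace ℝ F] {g : ℂ → F} {f : M → ℂ} {x : M}
    (hg : DifferentiableAt ℝ g (f x)) (hf : MDifferentiableAt 𝓘(ℝ, ℂ) 𝓘(ℝ, ℂ) f x) (v : ℂ) :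
    OneForm.coord (differential (g ∘ f)) x v =
      fderiv ℝ g (f x) (OneForm.coord (differential f) x v) := by
  have h := mfderiv_comp (I := 𝓘(ℝ, ℂ)) (I' := 𝓘(ℝ, ℂ)) (I'' := 𝓘(ℝ, F)) x
    hg.mdifferentiableAt hf
  rw [mfderiv_eq_fderiv] at h
  exact congrArg (fun T : ℂ →L[ℝ] F => T v) h

theorem differential_congr {M F : Type*} [TopologicalSpace M] [ChartedSpace ℂ M]
    [NormedAddCommGroup F] [NormedSpace ℝ F] {f g : M → F} {x : M} (h : f =ᶠ[𝓝 x] g) :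
    (differential f x : ℂ →L[ℝ] F) = differential g x :=
  h.mfderiv_eq

theorem fderiv_real_apply {f : ℂ → ℂ} {z : ℂ} (hf : DifferentiableAt ℂ f z) (v : ℂ) :
    fderiv ℝ f z v = deriv f z * v := by
  rw [hf.hasDerivAt.complexToReal_fderiv.fderiv]
  simp

theorem fderiv_real_re_apply {f : ℂ → ℂ} {z : ℂ} (hf : DifferentiableAt ℂ f z) (v : ℂ) :
    fderiv ℝ (fun w => (f w).re) z v = (deriv f z * v).re := by
  have h : HasFDerivAt (fun w => (f w).re) (reCLM.comp (fderiv ℝ f z)) z :=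
    reCLM.hasFDerivAt.comp z (hf.restrictScalars ℝ).hasFDerivAt
  rw [h.fderiv]
  exact congrArg re (fderiv_real_apply hf v)

theorem mdifferentiableAt_compatible_symm {Y : Type*} [TopologicalSpace Y] [ChartedSpace ℂ Y]
    [HasGroupoid Y dianalyticGroupoid] {e : OpenPartialHomeomorph Y ℂ} (he : e ∈ compatibleCharts Y)
    {z : ℂ} (hz : z ∈ e.target) :
    MDifferentiableAt 𝓘(ℝ, ℂ) 𝓘(ℝ, ℂ) e.symm z :=
  (contMDiffAt_symm_of_mem_maximalAtlas (n := ω)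
    (StructureGroupoid.maximalAtlas_mono dianalyticGroupoid_le he) hz).mdifferentiableAt (by simp)

/-! ### Lifted charts and the differential of the projection -/

namespace OrientationCover

variable {Y : Type*} [TopologicalSpace Y] [ChartedSpace ℂ Y] [HasGroupoid Y dianalyticGroupoid]

/-- The real-analytic structure underlying the Riemann surface `X`. -/
instance isManifold_real : IsManifold 𝓘(ℝ, ℂ) ω (OrientationCover Y) := by
  refine isManifold_of_contDiffOn _ _ _ fun f f' hf hf' => ?_
  obtain ⟨_, ⟨e, he, rfl⟩, rfl⟩ := mem_atlas_iff.1 hf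
  obtain ⟨_, ⟨e', he', rfl⟩, rfl⟩ := mem_atlas_iff.1 hf'
  simp only [mfld_simps]
  rintro z ⟨hz, hz1, hz2⟩
  have hz : z ∈ e.target := hz
  have h1 := (analyticAt_transition_iff he he' (e.map_target hz) hz1).2 hz2
  rw [e.right_inv hz] at h1
  exact (h1.contDiffAt.restrict_scalars ℝ).contDiffWithinAt

/-- The chart of the Riemann surface `X` induced by a compatible chart of `Y`. -/
def coverChart (e : OpenPartialHomeomorph Y ℂ) (he : e ∈ compatibleCharts Y) :
    OpenPartialHomeomorph (OrientationCover Y) ℂ :=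
  core.openPartialHomeomorph (liftChart e) ⟨e, he, rfl⟩

theorem coverChart_mem_atlas {e : OpenPartialHomeomorph Y ℂ} (he : e ∈ compatibleCharts Y) :
    coverChart e he ∈ atlas ℂ (OrientationCover Y) :=
  mem_atlas_iff.2 ⟨_, _, rfl⟩

theorem exists_coverChart_of_mem_atlas {E : OpenPartialHomeomorph (OrientationCover Y) ℂ}
    (hE : E ∈ atlas ℂ (OrientationCover Y)) : ∃ e, ∃ he : e ∈ compatibleCharts Y,
      E = coverChart e he := by
  obtain ⟨_, ⟨e, he, rfl⟩, rfl⟩ := mem_atlas_iff.1 hE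
  exact ⟨e, he, rfl⟩

theorem exists_coverChart (x : OrientationCover Y) : ∃ e, ∃ he : e ∈ compatibleCharts Y,
    x ∈ (coverChart e he).source :=
  ⟨_, preferredChart_mem x, mem_preferredChart_source x⟩

section

variable {e : OpenPartialHomeomorph Y ℂ} (he : e ∈ compatibleCharts Y) {x : OrientationCover Y}

theorem mdifferentiable_coverChart :
    (coverChart e he).MDifferentiable 𝓘(ℝ, ℂ) 𝓘(ℝ, ℂ) :=
  mdifferentiable_of_mem_atlas (coverChart_mem_atlas he)

/-- The differential of the lifted chart, in the coordinates of the tangent planes. -/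
def chartDeriv (x : OrientationCover Y) : ℂ →L[ℝ] ℂ := differential (coverChart e he) x

theorem chartDeriv_injective (hx : x ∈ (coverChart e he).source) :
    Function.Injective (chartDeriv he x) :=
  (mdifferentiable_coverChart he).mfderiv_injective hx

/-- Tangent coordinates at `x` come from the preferred chart of `X`, so this differential is the
derivative of a transition function of the Riemann surface, which is holomorphic. -/
theorem chartDeriv_I_mul (hx : x ∈ (coverChart e he).source) (v : ℂ) :
    chartDeriv he x (I * v) = I * chartDeriv he x v := by
  have h1 := mdifferentiableAt_atlas (I := 𝓘(ℂ, ℂ)) (coverChart_mem_atlas he) hx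
  have h2 : chartDeriv he x = fderiv ℝ (coverChart e he ∘ (chartAt ℂ x).symm) (chartAt ℂ x x) := by
    have h3 := (mdifferentiable_coverChart he).mdifferentiableAt hx
    have h5 := h3.mfderiv
    -- Both the real and the complex manifold derivative read the map in the same preferred chart,
    -- so the real derivative and the complex differentiability concern the same function on `ℂ`.
    simp only [writtenInExtChartAt, mfld_simps, fderivWithin_univ] at h5
    exact h5
  have h4 : DifferentiableAt ℂ (coverChart e he ∘ (chartAt ℂ x).symm) (chartAt ℂ x x) := by
    have h5 := h1.differentiableWithinAt_writtenInExtChartAt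
    simp only [writtenInExtChartAt, mfld_simps, differentiableWithinAt_univ] at h5
    exact h5
  rw [h2, fderiv_real_apply h4, fderiv_real_apply h4]
  ring

theorem mdifferentiableAt_proj (x : OrientationCover Y) :
    MDifferentiableAt 𝓘(ℝ, ℂ) 𝓘(ℝ, ℂ) (proj : OrientationCover Y → Y) x := by
  obtain ⟨e, he, hx⟩ := exists_coverChart x
  have h1 : MDifferentiableAt 𝓘(ℝ, ℂ) 𝓘(ℝ, ℂ) (e.symm ∘ coverChart e he) x :=
    (mdifferentiableAt_compatible_symm he ((coverChart e he).map_source hx)).comp x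
      ((mdifferentiable_coverChart he).mdifferentiableAt hx)
  refine h1.congr_of_eventuallyEq ?_
  filter_upwards [(coverChart e he).open_source.mem_nhds hx] with w hw
  exact (e.left_inv hw.1).symm

/-- The differential of the projection, in the coordinates of the tangent planes. -/
def projDeriv (x : OrientationCover Y) : ℂ →L[ℝ] ℂ :=
  mfderiv 𝓘(ℝ, ℂ) 𝓘(ℝ, ℂ) (proj : OrientationCover Y → Y) x

/-- The differential of the involution, in the coordinates of the tangent planes. -/
def involutionDeriv (x : OrientationCover Y) : ℂ →L[ℝ] ℂ :=
  mfderiv 𝓘(ℝ, ℂ) 𝓘(ℝ, ℂ) (involution : OrientationCover Y → OrientationCover Y) x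

/-- The lifted chart is `e ∘ π` by definition, so this is the chain rule. It makes `dπ` a right
factor of an injective map, whence `dπ` is injective, and bijective by equality of dimensions. -/
theorem chartDeriv_eq (hx : x ∈ (coverChart e he).source) (v : ℂ) :
    chartDeriv he x v = OneForm.coord (differential e) x.proj (projDeriv x v) :=
  congrArg (fun T : ℂ →L[ℝ] ℂ => T v)
    (mfderiv_comp (I := 𝓘(ℝ, ℂ)) (I' := 𝓘(ℝ, ℂ)) (I'' := 𝓘(ℝ, ℂ)) x
      (mdifferentiableAt_compatible he hx.1) (mdifferentiableAt_proj x))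

theorem projDeriv_injective (x : OrientationCover Y) : Function.Injective (projDeriv x) := by
  obtain ⟨e, he, hx⟩ := exists_coverChart x
  intro v w h
  apply chartDeriv_injective he hx
  rw [chartDeriv_eq he hx, chartDeriv_eq he hx, h]

theorem projDeriv_surjective (x : OrientationCover Y) : Function.Surjective (projDeriv x) :=
  LinearMap.injective_iff_surjective.1 (projDeriv_injective x)

end

/-! ### The involution and its anti-holomorphy -/

theorem chartOrientation_eq_neg {e e' : OpenPartialHomeomorph Y ℂ} (he : e ∈ compatibleCharts Y)
    (he' : e' ∈ compatibleCharts Y) {y : Y} (hy : y ∈ e.source) (hy' : y ∈ e'.source)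
    (h : AnalyticAt ℂ (fun z => (starRingEnd ℂ) ((e' ∘ e.symm) z)) (e y)) :
    chartOrientation e' y = -chartOrientation e y := by
  have hne : chartOrientation e' y ≠ chartOrientation e y := fun h1 => by
    -- Equal orientations would make the transition holomorphic as well as anti-holomorphic. Its
    -- Jacobian would then be both nonnegative and nonpositive, hence zero, which is impossible
    -- between charts.
    have h2 := (analyticAt_transition_iff he he' hy hy').2 h1.symm
    have h3 := chartJacobian_trans he he' hy hy'
    rw [le_antisymm (det_fderiv_nonpos_of_analyticAt_conj h) (det_fderiv_nonneg_of_analyticAt h2),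
      zero_mul] at h3
    exact chartJacobian_ne_zero he' hy' h3
  -- Stated over `ℂ`, which the tangent plane is by definition, so that the dimension condition can
  -- be checked there.
  have hor : ∀ o o' : Orientation ℝ ℂ (Fin 2), o ≠ o' → o = -o' := fun o o' =>
    (Orientation.ne_iff_eq_neg o o' (by simp)).1
  exact hor _ _ hne

/-- A holomorphic transition would mean that `e` and `e'` induce the same orientation, but these are
`x.orient` and `-x.orient`. -/
theorem analyticAt_conj_transition {e e' : OpenPartialHomeomorph Y ℂ}
    (he : e ∈ compatibleCharts Y) (he' : e' ∈ compatibleCharts Y) {x : OrientationCover Y}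
    (hx : x ∈ (coverChart e he).source) (hx' : x.involution ∈ (coverChart e' he').source) :
    AnalyticAt ℂ (fun z => (starRingEnd ℂ) ((e' ∘ e.symm) z)) (e x.proj) := by
  rcases dianalyticAt_transition he he' hx.1 hx'.1 with h | h
  · exfalso
    have h1 := (analyticAt_transition_iff he he' hx.1 hx'.1).1 h
    have h2 : -x.orient = x.orient := hx'.2.trans (h1.symm.trans hx.2.symm)
    exact Module.Ray.ne_neg_self x.orient h2.symm
  · exact h

/-- Read in lifted charts around `x` and `σ x`, the involution is the transition map `e' ∘ e.symm`,
which is real-analytic. -/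
theorem mdifferentiableAt_involution (x : OrientationCover Y) :
    MDifferentiableAt 𝓘(ℝ, ℂ) 𝓘(ℝ, ℂ)
      (involution : OrientationCover Y → OrientationCover Y) x := by
  obtain ⟨e, he, hx⟩ := exists_coverChart x
  obtain ⟨e', he', hx'⟩ := exists_coverChart x.involution
  have h0 := analyticAt_conj_transition he he' hx hx'
  have h1 : DifferentiableAt ℝ (e' ∘ e.symm) (coverChart e he x) :=
    (DianalyticAt.contDiffAt (Or.inr h0)).differentiableAt (by simp)
  have h2 : (e' ∘ e.symm) (coverChart e he x) = coverChart e' he' x.involution :=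
    congrArg e' (e.left_inv hx.1)
  have h3 := h1.mdifferentiableAt.comp x ((mdifferentiable_coverChart he).mdifferentiableAt hx)
  have h4 : MDifferentiableAt 𝓘(ℝ, ℂ) 𝓘(ℝ, ℂ) (coverChart e' he').symm
      (((e' ∘ e.symm) ∘ coverChart e he) x) :=
    (mdifferentiable_coverChart he').mdifferentiableAt_symm
      (by rw [Function.comp_apply, h2]; exact (coverChart e' he').map_source hx')
  refine (h4.comp x h3).congr_of_eventuallyEq ?_
  have h5 := (mdifferentiable_coverChart he).mdifferentiableAt hx |>.continuousAt.eventually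
    h0.eventually_analyticAt
  have h6 := (mdifferentiableAt_proj x).continuousAt.preimage_mem_nhds
    (e'.open_source.mem_nhds hx'.1)
  filter_upwards [h5, h6, (coverChart e he).open_source.mem_nhds hx] with w hw hw' hw''
  have h7 : (e' ∘ e.symm) (e w.proj) = e' w.proj := congrArg e' (e.left_inv hw''.1)
  -- Continuity of `σ` is not available here. That `σ w` stays in the lifted chart follows because
  -- the transition is still anti-holomorphic at nearby points, so `e'` still induces the opposite
  -- orientation.
  have h8 : w.involution ∈ (coverChart e' he').source := by
    refine ⟨hw', ?_⟩
    have h9 := chartOrientation_eq_neg he he' hw''.1 hw' hw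
    exact (congrArg (fun o : Module.Ray ℝ _ => -o) hw''.2).trans h9.symm
  have h10 := (coverChart e' he').left_inv h8
  exact h10.symm.trans (congrArg (coverChart e' he').symm h7.symm)

/-- The chain rule for `π ∘ σ = π`, which holds by definition. -/
theorem projDeriv_involutionDeriv (x : OrientationCover Y) (v : ℂ) :
    projDeriv x.involution (involutionDeriv x v) = projDeriv x v :=
  (congrArg (fun T : ℂ →L[ℝ] ℂ => T v)
    (mfderiv_comp (I := 𝓘(ℝ, ℂ)) (I' := 𝓘(ℝ, ℂ)) (I'' := 𝓘(ℝ, ℂ)) x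
      (mdifferentiableAt_proj x.involution) (mdifferentiableAt_involution x))).symm

/-- The involution `σ` is anti-holomorphic. -/
theorem involutionDeriv_I_mul (x : OrientationCover Y) (v : ℂ) :
    involutionDeriv x (I * v) = -(I * involutionDeriv x v) := by
  obtain ⟨e, he, hx⟩ := exists_coverChart x
  obtain ⟨e', he', hx'⟩ := exists_coverChart x.involution
  have h0 := analyticAt_conj_transition he he' hx hx'
  have hd : DifferentiableAt ℝ (e' ∘ e.symm) (coverChart e he x) :=
    (DianalyticAt.contDiffAt (Or.inr h0)).differentiableAt (by simp)
  -- In lifted charts `dσ` is the derivative of the transition map.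
  have h1 : ∀ v, chartDeriv he' x.involution (involutionDeriv x v) =
      fderiv ℝ (e' ∘ e.symm) (e x.proj) (chartDeriv he x v) := fun v => by
    have h2 : (coverChart e' he' ∘ involution : OrientationCover Y → ℂ) =ᶠ[𝓝 x]
        (e' ∘ e.symm) ∘ coverChart e he := by
      filter_upwards [(coverChart e he).open_source.mem_nhds hx] with w hw
      exact congrArg e' (e.left_inv hw.1).symm
    have h3 := congrArg (fun T : ℂ →L[ℝ] ℂ => T v) (differential_congr h2)
    have h4 := congrArg (fun T : ℂ →L[ℝ] ℂ => T v)
      (mfderiv_comp (I := 𝓘(ℝ, ℂ)) (I' := 𝓘(ℝ, ℂ)) (I'' := 𝓘(ℝ, ℂ)) x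
      ((mdifferentiable_coverChart he').mdifferentiableAt hx') (mdifferentiableAt_involution x))
    exact h4.symm.trans (h3.trans (differential_comp_apply hd
      ((mdifferentiable_coverChart he).mdifferentiableAt hx) v))
  -- The conjugate of the transition map is holomorphic, so its own derivative is a complex
  -- multiplication followed by conjugation, which is conjugate linear.
  have h5 : ∀ v, fderiv ℝ (e' ∘ e.symm) (e x.proj) v =
      (starRingEnd ℂ) (deriv (fun z => (starRingEnd ℂ) ((e' ∘ e.symm) z)) (e x.proj) * v) := by
    intro v
    rw [← fderiv_real_apply h0.differentiableAt]
    have h6 : fderiv ℝ (fun w => (starRingEnd ℂ) ((e' ∘ e.symm) w)) (e x.proj) =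
        (conjCLE : ℂ →L[ℝ] ℂ).comp (fderiv ℝ (e' ∘ e.symm) (e x.proj)) :=
      ((conjCLE : ℂ →L[ℝ] ℂ).hasFDerivAt.comp (e x.proj) hd.hasFDerivAt).fderiv
    rw [h6]
    simp
  apply chartDeriv_injective he' hx'
  rw [map_neg, chartDeriv_I_mul he' hx', h1, h1, chartDeriv_I_mul he hx, h5, h5]
  simp only [map_mul, conj_I]
  ring

end OrientationCover

/-! ### Complex-linear forms and their real parts -/

namespace OneForm

/-- The complex one-form `β + i *β` attached to a real one-form `β` on a Riemann surface. -/
def addIHodge {M : Type*} [TopologicalSpace M] [ChartedSpace ℂ M] (β : OneForm M ℝ) : OneForm M ℂ :=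
  ofReal β + Complex.I • ofReal (hodgeStar β)

variable {M : Type*} [TopologicalSpace M] [ChartedSpace ℂ M]

theorem addIHodge_apply (β : OneForm M ℝ) (x : M) (v : ℂ) :
    OneForm.coord (addIHodge β) x v =
      (OneForm.coord β x v : ℂ) - I * (OneForm.coord β x (I * v) : ℂ) := by
  have h : OneForm.coord (addIHodge β) x v =
      (OneForm.coord β x v : ℂ) + I * ((-OneForm.coord β x (I * v) : ℝ) : ℂ) := rfl
  rw [h]
  push_cast
  ring

theorem re_addIHodge (β : OneForm M ℝ) (x : M) (v : ℂ) :
    (OneForm.coord (addIHodge β) x v).re = OneForm.coord β x v := by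
  rw [addIHodge_apply]
  simp

/-- Replacing `v` by `iv` in `β(v) - i β(iv)` multiplies it by `i`. The verification expands the
real-linear `β` in the basis `1, i`. -/
theorem addIHodge_smul_apply (β : OneForm M ℝ) (x : M) (c v : ℂ) :
    OneForm.coord (addIHodge β) x (c * v) = c * OneForm.coord (addIHodge β) x v := by
  let b : ℂ →L[ℝ] ℝ := β x
  have hb : ∀ w : ℂ, b w = w.re * b 1 + w.im * b I := fun w => by
    conv_lhs => rw [← re_add_im w]
    have h1 : (w.re : ℂ) + w.im * I = w.re • (1 : ℂ) + w.im • I := by simp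
    rw [h1, map_add, map_smul, map_smul]
    rfl
  have h : ∀ w, OneForm.coord (addIHodge β) x w = (b w : ℂ) - I * (b (I * w) : ℂ) :=
    addIHodge_apply β x
  rw [h, h, hb (c * v), hb (I * (c * v)), hb v, hb (I * v)]
  apply Complex.ext
  · simp
    ring
  · simp
    ring

/-- A form that is complex linear on the tangent planes is determined by its real part. -/
theorem eq_addIHodge {θ : OneForm M ℂ} {β : OneForm M ℝ}
    (hI : ∀ x (v : ℂ), OneForm.coord θ x (I * v) = I * OneForm.coord θ x v)
    (hre : ∀ x (v : ℂ), (OneForm.coord θ x v).re = OneForm.coord β x v) : θ = addIHodge β := by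
  refine OneForm.ext_coord fun x v => ?_
  refine Eq.trans ?_ (addIHodge_apply β x v).symm
  -- The imaginary part is forced by complex linearity: `Im θ(v) = -Re θ(iv)`.
  rw [← hre, ← hre, hI]
  apply Complex.ext <;> simp

end OneForm

/-! ### From harmonic forms on `Y` to invariant holomorphic forms on `X` -/

namespace OrientationCover

variable {Y : Type*} [TopologicalSpace Y] [ChartedSpace ℂ Y] [HasGroupoid Y dianalyticGroupoid]

theorem pullback_proj_apply (η : OneForm Y ℝ) (x : OrientationCover Y) (v : ℂ) :
    OneForm.coord (OneForm.pullback proj η) x v = OneForm.coord η x.proj (projDeriv x v) := rfl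

theorem holomorphicForm_I_mul {θ : OneForm (OrientationCover Y) ℂ} (hθ : IsHolomorphicForm θ)
    (x : OrientationCover Y) (v : ℂ) : OneForm.coord θ x (I * v) = I * OneForm.coord θ x v := by
  obtain ⟨e, he, hx⟩ := exists_coverChart x
  obtain ⟨f, -, hf⟩ := hθ _ (coverChart_mem_atlas he)
  have h : ∀ w, OneForm.coord θ x w = f (e x.proj) * chartDeriv he x w := fun w =>
    congrArg (fun T : ℂ →L[ℝ] ℂ => T w) (hf x hx)
  rw [h, h, chartDeriv_I_mul he hx]
  ring

/-- If `η = df` on `Y` with `f = Re G` in the chart `e`, then `π^*η = Re (G' de)`. -/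
theorem pullback_proj_eq_re {η : OneForm Y ℝ} {f : Y → ℝ} {e : OpenPartialHomeomorph Y ℂ}
    (he : e ∈ compatibleCharts Y) {x : OrientationCover Y} (hx : x ∈ (coverChart e he).source)
    (hη : η x.proj = differential f x.proj) {G : ℂ → ℂ} (hG : DifferentiableAt ℂ G (e x.proj))
    (hf : (f ∘ e.symm) =ᶠ[𝓝 (e x.proj)] fun z => (G z).re) (v : ℂ) :
    OneForm.coord (OneForm.pullback proj η) x v = (deriv G (e x.proj) * chartDeriv he x v).re := by
  have hd : DifferentiableAt ℝ (f ∘ e.symm) (e x.proj) :=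
    (reCLM.differentiableAt.comp (e x.proj) (hG.restrictScalars ℝ)).congr_of_eventuallyEq hf
  have h1 : OneForm.coord η x.proj = OneForm.coord (differential f) x.proj := hη
  have h2 : OneForm.coord (differential f) x.proj (projDeriv x v) =
      fderiv ℝ (f ∘ e.symm) (e x.proj) (OneForm.coord (differential e) x.proj (projDeriv x v)) :=
    differential_comp he hx.1 hd _
  rw [pullback_proj_apply, h1, h2, hf.fderiv_eq, fderiv_real_re_apply hG, chartDeriv_eq he hx]

/-- Locally `η = d(Re G)` with `G` holomorphic, and `G' de` is the complex-linear form with real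
part `π^*η`. Holomorphy is local, so it suffices to find such a `G` on a disc around each point of
the chart. -/
theorem isHolomorphicForm_addIHodge {η : OneForm Y ℝ} (hη : IsHarmonicForm η) :
    IsHolomorphicForm (OneForm.addIHodge (OneForm.pullback proj η)) := by
  intro E hE
  obtain ⟨e, he, rfl⟩ := exists_coverChart_of_mem_atlas hE
  set θ := OneForm.addIHodge (OneForm.pullback proj η) with hθ
  have hne : ∀ x ∈ (coverChart e he).source, chartDeriv he x 1 ≠ 0 := fun x hx h =>
    one_ne_zero (chartDeriv_injective he hx (h.trans (map_zero _).symm))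
  have hlin : ∀ x ∈ (coverChart e he).source, ∀ v : ℂ,
      chartDeriv he x v = v * chartDeriv he x 1 := fun x hx v => by
    conv_lhs => rw [← re_add_im v]
    have h1 : (v.re : ℂ) + v.im * I = v.re • (1 : ℂ) + v.im • (I * 1) := by simp
    rw [h1, map_add, map_smul, map_smul, chartDeriv_I_mul he hx]
    conv_rhs => rw [← re_add_im v]
    simp only [real_smul]
    ring
  have hlinθ : ∀ x, ∀ v : ℂ, OneForm.coord θ x v = v * OneForm.coord θ x (1 : ℂ) := fun x v => by
    conv_lhs => rw [← mul_one v]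
    exact OneForm.addIHodge_smul_apply _ x v 1
  -- The coefficient of `θ` relative to `de`, as a quotient of values on the tangent vector `1`.
  -- This defines it on the whole chart at once, with no gluing of the local functions `G'`.
  let F : ℂ → ℂ := fun z => OneForm.coord θ ((coverChart e he).symm z) (1 : ℂ) /
    chartDeriv he ((coverChart e he).symm z) 1
  refine ⟨F, fun z hz => ?_, fun x hx => ?_⟩
  · have hz : z ∈ e.target := hz
    obtain ⟨U, hU, hyU, f, hf, hηf⟩ := hη (e.symm z)
    have hh : HarmonicAt (f ∘ e.symm) z := by
      have := hf.harmonicAt he (e.map_target hz) hyU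
      rwa [e.right_inv hz] at this
    have hnear : ∀ᶠ w in 𝓝 z, HarmonicAt (f ∘ e.symm) w ∧ w ∈ e.target ∧ e.symm w ∈ U :=
      hh.eventually.and ((e.open_target.eventually_mem hz).and
        ((e.continuousAt_symm hz).eventually (hU.eventually_mem hyU)))
    obtain ⟨r, hr, hr'⟩ := Metric.eventually_nhds_iff_ball.1 hnear
    -- On a disc a harmonic function is the real part of a holomorphic one.
    obtain ⟨G, hG, hG'⟩ := InnerProductSpace.HarmonicOnNhd.exists_analyticOnNhd_ball_re_eq
      (fun w hw => (hr' w hw).1)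
    have hFG : ∀ w ∈ Metric.ball z r, F w = deriv G w := fun w hw => by
      obtain ⟨-, hwt, hwU⟩ := hr' w hw
      set x := (coverChart e he).symm w with hxdef
      have hx : x ∈ (coverChart e he).source := (coverChart e he).map_target hwt
      have hxw : e x.proj = w := e.right_inv hwt
      have hβ : ∀ v : ℂ, OneForm.coord (OneForm.pullback proj η) x v =
          (deriv G w * chartDeriv he x v).re := by
        have h1 := pullback_proj_eq_re he hx (hηf _ hwU) (G := G)
          (by rw [hxw]; exact (hG w hw).differentiableAt)
          (by
            rw [hxw]
            filter_upwards [Metric.isOpen_ball.mem_nhds hw] with u hu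
            exact (hG' hu).symm)
        rwa [hxw] at h1
      have h2 : OneForm.coord θ x (1 : ℂ) = deriv G w * chartDeriv he x 1 := by
        refine (OneForm.addIHodge_apply _ x 1).trans ?_
        rw [hβ, hβ, chartDeriv_I_mul he hx]
        exact Complex.ext (by simp) (by simp; ring)
      change OneForm.coord θ x (1 : ℂ) / chartDeriv he x 1 = _
      rw [h2, mul_div_cancel_right₀ _ (hne x hx)]
    have hzr := Metric.mem_ball_self (x := z) hr
    have hFz : F =ᶠ[𝓝 z] deriv G :=
      Filter.eventually_of_mem (Metric.isOpen_ball.mem_nhds hzr) hFG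
    exact ((hG z hzr).deriv.differentiableAt.congr_of_eventuallyEq hFz).differentiableWithinAt
  · refine ContinuousLinearMap.ext fun (v : ℂ) => ?_
    have hF : F (coverChart e he x) = OneForm.coord θ x (1 : ℂ) / chartDeriv he x 1 := by
      simp only [F]
      rw [(coverChart e he).left_inv hx]
    have h1 : OneForm.coord θ x v = F (coverChart e he x) * chartDeriv he x v := by
      rw [hlinθ, hF, hlin x hx v]
      field_simp [hne x hx]
    exact h1

/-- Since `π ∘ σ = π`, the term `β(v)` is unchanged, while `i dσ(v) = dσ(-iv)` flips the sign of
`β(iv)`. The result is the conjugate of `β(v) - i β(iv)`. -/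
theorem pullback_involution_addIHodge (η : OneForm Y ℝ) :
    OneForm.pullback involution (OneForm.addIHodge (OneForm.pullback proj η)) =
      OneForm.conj (OneForm.addIHodge (OneForm.pullback proj η)) := by
  refine OneForm.ext_coord fun x v => ?_
  refine (OneForm.addIHodge_apply _ x.involution (involutionDeriv x v)).trans ?_
  refine Eq.trans ?_ (congrArg (starRingEnd ℂ) (OneForm.addIHodge_apply _ x v)).symm
  have h1 : I * involutionDeriv x v = involutionDeriv x (-(I * v)) := by
    rw [map_neg, involutionDeriv_I_mul, neg_neg]
  rw [h1]
  simp only [pullback_proj_apply, projDeriv_involutionDeriv, proj_involution]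
  have h2 : OneForm.coord η x.proj (projDeriv x (-(I * v))) =
      -OneForm.coord η x.proj (projDeriv x (I * v)) := by
    rw [map_neg, map_neg]
  rw [h2]
  simp

theorem pullback_proj_injective :
    Function.Injective (OneForm.pullback proj : OneForm Y ℝ → OneForm (OrientationCover Y) ℝ) := by
  intro η η' h
  funext y
  refine ContinuousLinearMap.ext fun (v : ℂ) => ?_
  -- Some point over `y`; any orientation would do, since `dπ` is surjective at every point of `X`.
  let x : OrientationCover Y := ⟨y, chartOrientation (chartAt ℂ y) y⟩
  obtain ⟨w, rfl⟩ := projDeriv_surjective x v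
  exact congrArg (fun T : ℂ →L[ℝ] ℝ => T w) (congrFun h x)

/-! ### Descent from `X` to `Y` -/

/-- The differential of the projection as a linear isomorphism of the tangent planes. -/
def projDerivEquiv (x : OrientationCover Y) : ℂ ≃L[ℝ] ℂ :=
  (LinearEquiv.ofBijective (projDeriv x : ℂ →ₗ[ℝ] ℂ)
    ⟨projDeriv_injective x, projDeriv_surjective x⟩).toContinuousLinearEquiv

theorem projDerivEquiv_symm_projDeriv (x : OrientationCover Y) (v : ℂ) :
    (projDerivEquiv x).symm (projDeriv x v) = v :=
  (projDerivEquiv x).symm_apply_apply v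

/-- The descent to `Y` of the real part of a one-form on `X`. -/
def descendRe (θ : OneForm (OrientationCover Y) ℂ) : OneForm Y ℝ := fun y =>
  let x : OrientationCover Y := ⟨y, chartOrientation (chartAt ℂ y) y⟩
  show ℂ →L[ℝ] ℝ from reCLM.comp ((show ℂ →L[ℝ] ℂ from θ x).comp
    ((projDerivEquiv x).symm : ℂ →L[ℝ] ℂ))

/-- The descent picks one of the two points over each `y`. Invariance makes the choice irrelevant:
moving to the other sheet conjugates `θ`, which does not affect the real part. -/
theorem pullback_proj_descendRe {θ : OneForm (OrientationCover Y) ℂ}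
    (hσ : OneForm.pullback involution θ = OneForm.conj θ) (x : OrientationCover Y) (v : ℂ) :
    OneForm.coord (OneForm.pullback proj (descendRe θ)) x v = (OneForm.coord θ x v).re := by
  let x' : OrientationCover Y := ⟨x.pt, chartOrientation (chartAt ℂ x.pt) x.pt⟩
  have h1 : OneForm.coord (OneForm.pullback proj (descendRe θ)) x v =
      (OneForm.coord θ x' ((projDerivEquiv x').symm (projDeriv x v))).re := rfl
  rw [h1]
  have hor : ∀ o o' : Orientation ℝ ℂ (Fin 2), o = o' ∨ o = -o' := fun o o' =>
    Orientation.eq_or_eq_neg o o' (by simp)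
  have hx : x' = x ∨ x' = x.involution :=
    (hor (chartOrientation (chartAt ℂ x.pt) x.pt) x.orient).imp
      (fun h => congrArg (OrientationCover.mk x.pt) h)
      (fun h => congrArg (OrientationCover.mk x.pt) h)
  rcases hx with hx | hx
  · rw [hx, projDerivEquiv_symm_projDeriv]
  · rw [hx, ← projDeriv_involutionDeriv, projDerivEquiv_symm_projDeriv]
    have h2 : OneForm.coord θ x.involution (involutionDeriv x v) =
        (starRingEnd ℂ) (OneForm.coord θ x v) :=
      congrArg (fun T : ℂ →L[ℝ] ℂ => T v) (congrFun hσ x)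
    rw [h2, conj_re]

/-- If `θ = F de` in a lifted chart and `G` is a primitive of `F` on a disc, then the descended form
is the differential of `Re G ∘ e`. Equality on `Y` is tested after pulling back, where both sides
are the real part of `F de`. -/
theorem isHarmonicForm_descendRe {θ : OneForm (OrientationCover Y) ℂ} (hθ : IsHolomorphicForm θ)
    (hσ : OneForm.pullback involution θ = OneForm.conj θ) : IsHarmonicForm (descendRe θ) := by
  intro y
  let e := chartAt ℂ y
  have he : e ∈ compatibleCharts Y := dianalyticGroupoid.chart_mem_maximalAtlas y
  have hy : y ∈ e.source := mem_chart_source ℂ y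
  obtain ⟨F, hF, hθF⟩ := hθ _ (coverChart_mem_atlas he)
  obtain ⟨r, hr, hr'⟩ := Metric.isOpen_iff.1 e.open_target (e y) (e.map_source hy)
  obtain ⟨G, hG⟩ := (hF.mono hr').isExactOn_ball
  have hGa : AnalyticOnNhd ℂ G (Metric.ball (e y) r) :=
    DifferentiableOn.analyticOnNhd
      (fun z hz => (hG z hz).differentiableAt.differentiableWithinAt) Metric.isOpen_ball
  let U := e.source ∩ e ⁻¹' Metric.ball (e y) r
  have hU : IsOpen U := e.isOpen_inter_preimage Metric.isOpen_ball
  let f : Y → ℝ := fun w => (G (e w)).re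
  have hf : ∀ w ∈ U, (f ∘ e.symm) =ᶠ[𝓝 (e w)] fun z => (G z).re := fun w hw => by
    filter_upwards [e.open_target.mem_nhds (e.map_source hw.1)] with z hz
    simp only [f, Function.comp_apply, e.right_inv hz]
  refine ⟨U, hU, ⟨hy, Metric.mem_ball_self hr⟩, f, ?_, fun w hw => ?_⟩
  · intro w hw
    -- Harmonicity on `U` asks for a chart whose whole domain lies in `U`, hence the restriction.
    refine ⟨e.restr U, restr_mem_maximalAtlas dianalyticGroupoid he hU,
      by simp [hU.interior_eq, hw, hw.1], by simp [hU.interior_eq], fun z hz => ?_⟩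
    have hzU : e.symm z ∈ U := by
      have := (e.restr U).map_target hz
      simp only [OpenPartialHomeomorph.restr_source, hU.interior_eq] at this
      exact this.2
    have hz' : e (e.symm z) = z := e.right_inv ((e.restr U).right_inv hz ▸
      e.map_source ((e.restr U).map_target hz).1)
    have h1 := hf _ hzU
    have h2 := hzU.2
    rw [mem_preimage, hz'] at h2
    rw [hz'] at h1
    exact (harmonicAt_congr_nhds h1).2 (hGa z h2).harmonicAt_re
  · let x : OrientationCover Y := ⟨w, chartOrientation e w⟩
    have hx : x ∈ (coverChart e he).source := ⟨hw.1, rfl⟩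
    refine ContinuousLinearMap.ext fun (v : ℂ) => ?_
    obtain ⟨u, rfl⟩ := projDeriv_surjective x v
    have h1 := pullback_proj_eq_re (η := differential f) he hx rfl
      (hG _ hw.2).differentiableAt (hf w hw) u
    have hd : deriv G (e x.proj) = F (e w) := (hG _ hw.2).deriv
    rw [hd] at h1
    have h2 : OneForm.coord θ x u = F (e w) * chartDeriv he x u :=
      congrArg (fun T : ℂ →L[ℝ] ℂ => T u) (hθF x hx)
    have h3 := pullback_proj_descendRe hσ x u
    rw [h2] at h3
    exact h3.trans h1.symm

theorem addIHodge_descendRe {θ : OneForm (OrientationCover Y) ℂ} (hθ : IsHolomorphicForm θ)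
    (hσ : OneForm.pullback involution θ = OneForm.conj θ) :
    θ = OneForm.addIHodge (OneForm.pullback proj (descendRe θ)) :=
  OneForm.eq_addIHodge (holomorphicForm_I_mul hθ)
    fun x v => (pullback_proj_descendRe hσ x v).symm

/-! ### The isomorphism -/

/-- The map `η ↦ π^*η + i *π^*η` from harmonic forms to invariant holomorphic forms. -/
def harmonicToInvariant : harmonicForms Y →ₗ[ℝ] sigmaInvariantForms Y where
  toFun η := ⟨OneForm.addIHodge (OneForm.pullback proj (η : OneForm Y ℝ)),
    isHolomorphicForm_addIHodge η.2, pullback_involution_addIHodge _⟩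
  map_add' η η' := by
    refine Subtype.ext (OneForm.ext_coord fun x v => ?_)
    refine (OneForm.addIHodge_apply _ x v).trans (Eq.trans ?_ (congrArg₂ (· + ·)
      (OneForm.addIHodge_apply _ x v) (OneForm.addIHodge_apply _ x v)).symm)
    have h : ∀ w, OneForm.coord (OneForm.pullback proj
        ((η + η' : harmonicForms Y) : OneForm Y ℝ)) x w =
      OneForm.coord (OneForm.pullback proj (η : OneForm Y ℝ)) x w +
        OneForm.coord (OneForm.pullback proj (η' : OneForm Y ℝ)) x w := fun _ => rfl
    rw [h, h]
    push_cast
    ring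
  map_smul' c η := by
    refine Subtype.ext (OneForm.ext_coord fun x v => ?_)
    refine (OneForm.addIHodge_apply _ x v).trans (Eq.trans ?_
      (congrArg (fun z : ℂ => c • z) (OneForm.addIHodge_apply _ x v)).symm)
    have h : ∀ w, OneForm.coord (OneForm.pullback proj
        ((c • η : harmonicForms Y) : OneForm Y ℝ)) x w =
      c * OneForm.coord (OneForm.pullback proj (η : OneForm Y ℝ)) x w := fun _ => rfl
    rw [h, h]
    simp only [real_smul]
    push_cast
    ring

/-- Taking real parts recovers `π^*η`, and `π^*` is injective; `descendRe` supplies the preimage of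
an invariant form. -/
theorem harmonicToInvariant_bijective :
    Function.Bijective (harmonicToInvariant : harmonicForms Y →ₗ[ℝ] sigmaInvariantForms Y) := by
  constructor
  · intro η η' h
    refine Subtype.ext (pullback_proj_injective (OneForm.ext_coord fun x v => ?_))
    have h1 := congrArg (fun T : ℂ →L[ℝ] ℂ => (T v).re) (congrFun (congrArg Subtype.val h) x)
    exact (OneForm.re_addIHodge _ x v).symm.trans (h1.trans (OneForm.re_addIHodge _ x v))
  · rintro ⟨θ, hθ, hσ⟩
    exact ⟨⟨descendRe θ, isHarmonicForm_descendRe hθ hσ⟩,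
      Subtype.ext (addIHodge_descendRe hθ hσ).symm⟩

end OrientationCover

end

/-- `X = OrientationCover Y` is the orientation double cover of `Y`, with projection
`π = OrientationCover.proj` and anti-holomorphic involution `σ = OrientationCover.involution`. -/
theorem mainTheorem1 {Y : Type*} [TopologicalSpace Y] [ChartedSpace ℂ Y] [KleinSurface Y] :
    (∀ θ ∈ holomorphicForms (OrientationCover Y),
      OneForm.pullback OrientationCover.involution θ = OneForm.conj θ ↔
        ∃ η ∈ harmonicForms Y, ∃ β : OneForm (OrientationCover Y) ℝ,
          β = OneForm.pullback OrientationCover.proj η ∧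
          θ = OneForm.ofReal β + Complex.I • OneForm.ofReal (OneForm.hodgeStar β)) ∧
    ∃ φ : harmonicForms Y ≃ₗ[ℝ] sigmaInvariantForms Y, ∀ η : harmonicForms Y,
      (φ η : OneForm (OrientationCover Y) ℂ) =
        OneForm.ofReal (OneForm.pullback OrientationCover.proj (η : OneForm Y ℝ)) +
          Complex.I • OneForm.ofReal
            (OneForm.hodgeStar (OneForm.pullback OrientationCover.proj (η : OneForm Y ℝ))) := by
  refine ⟨fun θ hθ => ⟨fun hσ => ?_, ?_⟩,
    LinearEquiv.ofBijective _ OrientationCover.harmonicToInvariant_bijective, fun η => rfl⟩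
  · exact ⟨_, OrientationCover.isHarmonicForm_descendRe hθ hσ, _, rfl,
      OrientationCover.addIHodge_descendRe hθ hσ⟩
  · rintro ⟨η, -, _, rfl, rfl⟩
    exact OrientationCover.pullback_involution_addIHodge η
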